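/- All graphs are finite and simple. For a connected graph $G$ on $n$ vertices let $\partial_1(G)\ge\partial_2(G)\ge\cdots\ge\partial_n(G)$ be the eigenvalues, with multiplicity, of its distance matrix $D(G)=(d(u,v))_{u,v}$. Let $\mathcal{G}[-3\le\partial_n,\partial_3\le-1]$ be the set of connected, non-complete graphs $G$ on $n\ge4$ vertices with $\partial_n(G)\ge-3$ and $\partial_3(G)\le-1$. Write $G\vee H$ for the join of two vertex-disjoint graphs (their disjoint union together with all edges between them), $G\cup H$ for the disjoint union, $mH$ for the disjoint union of $m\ge0$ copies of $H$, $K_n$ for the complete graph on $n$ vertices, and $P_3$ for the path on three vertices. Theorem 3.12. Let $G\cong G_1\vee G_2$, where $G_1$ and $G_2$ have at least one vertex each, and suppose that $G\in\mathcal{G}[-3\le\partial_n,\partial_3\le-1]$. (i) If neither $G_1$ nor $G_2$ contains an induced $P_3$, then $G$ is one of the following, for some non-negative integers as indicated: (a) $G\cong K_r\vee(K_s\cup tK_1)$ with $r,t\ge1$ and $s\ge3$; (b) $G\cong K_r\vee(mK_2\cup tK_1)$ with $r\ge1$ and $m+t\ge2$; (c) $G\cong(K_{s_1}\cup t_1K_1)\vee(K_{s_2}\cup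 t_2K_1)$ with $s_1,s_2\ge3$ and $t_1,t_2\ge1$; (d) $G\cong(K_s\cup t_1K_1)\vee(mK_2\cup t_2K_1)$ with $s\ge3$, $t_1\ge1$ and $m+t_2\ge2$; (e) $G\cong(m_1K_2\cup t_1K_1)\vee(m_2K_2\cup t_2K_1)$ with $m_1+t_1\ge2$ and $m_2+t_2\ge2$. (ii) If $G_1$ or $G_2$ contains an induced $P_3$, then $G\cong K_r\vee F_1\vee F_2$ for some $r\ge1$ and some graphs $F_1,F_2$, each with at least one vertex and neither containing an induced $P_3$. -/

import Mathlib

open scoped SimpleGraph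

namespace SimpleGraph

/-- The join of two vertex-disjoint graphs: their disjoint union together with all edges
having one end in each of them. -/
def join {V W : Type*} (G : SimpleGraph V) (H : SimpleGraph W) : SimpleGraph (V ⊕ W) :=
  (G ⊕g H) ⊔ completeBipartiteGraph V W

/-- The disjoint union of `m` copies of a graph `H`; the first coordinate tells the copy. -/
def copies {V : Type*} (m : ℕ) (H : SimpleGraph V) : SimpleGraph (Fin m × V) where
  Adj x y := x.1 = y.1 ∧ H.Adj x.2 y.2
  symm := ⟨fun _ _ h => ⟨h.1.symm, h.2.symm⟩⟩
  loopless := ⟨fun _ h => H.irrefl h.2⟩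

/-- The complete graph `K_n` on `n` vertices. -/
abbrev clique (n : ℕ) : SimpleGraph (Fin n) := completeGraph (Fin n)

/-- The graph `K_s ∪ t K_1`. -/
abbrev cliqueUnionIsolated (s t : ℕ) : SimpleGraph (Fin s ⊕ Fin t × Fin 1) :=
  clique s ⊕g copies t (clique 1)

/-- The graph `m K_2 ∪ t K_1`. -/
abbrev edgesUnionIsolated (m t : ℕ) : SimpleGraph (Fin m × Fin 2 ⊕ Fin t × Fin 1) :=
  copies m (clique 2) ⊕g copies t (clique 1)

/-- `G` contains the path on three vertices as an induced subgraph. -/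
def HasInducedP3 {V : Type*} (G : SimpleGraph V) : Prop := pathGraph 3 ⊴ G

/-- The distance matrix of a graph. -/
noncomputable def distanceMatrix {V : Type*} (G : SimpleGraph V) : Matrix V V ℝ :=
  Matrix.of fun u v => (G.dist u v : ℝ)

theorem distanceMatrix_isHermitian {V : Type*} (G : SimpleGraph V) :
    G.distanceMatrix.IsHermitian := by
  ext u v
  simp [distanceMatrix, SimpleGraph.dist_comm]

/-- The distance eigenvalues `∂₁ ≥ ∂₂ ≥ ⋯ ≥ ∂ₙ` of `G`, listed with multiplicity in weakly
decreasing order. The index starts at `0`: `∂ₖ` is the value at `k - 1`. -/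
noncomputable def distanceEigenvalue {V : Type*} [Fintype V] [DecidableEq V]
    (G : SimpleGraph V) : Fin (Fintype.card V) → ℝ :=
  G.distanceMatrix_isHermitian.eigenvalues₀

/-- The class `𝒢[-3 ≤ ∂ₙ, ∂₃ ≤ -1]`: non-complete connected graphs on `n ≥ 4` vertices whose
least distance eigenvalue is at least `-3` and whose third largest one is at most `-1`. -/
def InClassG {V : Type*} [Fintype V] [DecidableEq V] (G : SimpleGraph V) : Prop :=
  G.Connected ∧ G ≠ ⊤ ∧ ∃ hn : 4 ≤ Fintype.card V,
    -3 ≤ G.distanceEigenvalue ⟨Fintype.card V - 1, by omega⟩ ∧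
    G.distanceEigenvalue ⟨2, by omega⟩ ≤ -1

end SimpleGraph

/-!
If `G` has diameter at most two then `D(G) + I = J + A(Gᶜ)`, where `J` is the all-ones matrix, and
every principal submatrix inherits this form. Hence `∂ₙ ≥ -3` forbids an induced `K₃ ∪ K₂`, which
pins down the sides of the join without induced `P₃`. If instead `∂₃ ≤ -1` and one side contains
an induced `P₃`, then every vertex in the middle of an induced `P₃` of `G` is universal, and so is
every vertex of the other side. Removing the at least two universal vertices of `G` leaves a graph
without induced `P₃`.
-/

open SimpleGraph Matrix

namespace DistanceSpectrum

section Eigenvalues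

open scoped ComplexOrder

variable {𝕜 V ι : Type*} [RCLike 𝕜] [Fintype V] [DecidableEq V] [Fintype ι] {A : Matrix V V 𝕜}

theorem sub_smul_one_eq_conj_diagonal (hA : A.IsHermitian) (r : ℝ) :
    A - r • (1 : Matrix V V 𝕜) = (hA.eigenvectorUnitary : Matrix V V 𝕜) *
      diagonal (fun v => ((hA.eigenvalues v - r : ℝ) : 𝕜)) *
        (hA.eigenvectorUnitary : Matrix V V 𝕜)ᴴ := by
  have hdiag : diagonal (fun v => ((hA.eigenvalues v - r : ℝ) : 𝕜)) =
      diagonal (RCLike.ofReal ∘ hA.eigenvalues) - r • (1 : Matrix V V 𝕜) := by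
    ext i j
    by_cases h : i = j <;> simp [diagonal, h, RCLike.real_smul_eq_coe_mul]
  rw [hdiag, mul_sub, sub_mul]
  conv_lhs => rw [hA.spectral_theorem]
  simp [Unitary.conjStarAlgAut_apply, ← star_eq_conjTranspose]

theorem posSemidef_sub_smul_one (hA : A.IsHermitian) {r : ℝ} (h : ∀ i, r ≤ hA.eigenvalues₀ i) :
    (A - r • (1 : Matrix V V 𝕜)).PosSemidef := by
  rw [sub_smul_one_eq_conj_diagonal hA]
  refine (PosSemidef.diagonal fun v => ?_).mul_mul_conjTranspose_same _
  exact RCLike.ofReal_nonneg.2 (sub_nonneg.2 (h _))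

/-- One half of the Courant–Fischer principle, for the column space of `P`. -/
theorem lt_eigenvalues₀_of_posDef (hA : A.IsHermitian) {r : ℝ} (P : Matrix V ι 𝕜)
    (hP : (Pᴴ * (A - r • (1 : Matrix V V 𝕜)) * P).PosDef) (k : Fin (Fintype.card V))
    (hk : k < Fintype.card ι) : r < hA.eigenvalues₀ k := by
  by_contra! hle
  let Q : Matrix V ι 𝕜 := (hA.eigenvectorUnitary : Matrix V V 𝕜)ᴴ * P
  let e : Fin (Fintype.card V) ≃ V := Fintype.equivOfCardEq (Fintype.card_fin _)
  obtain ⟨a, hker, ha⟩ := Submodule.exists_mem_ne_zero_of_ne_bot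
    (LinearMap.ker_ne_bot_of_finrank_lt
      (f := (Q.submatrix (fun j : Fin k => e (j.castLE k.2.le)) id).mulVecLin) (by simpa))
  have hzero (i : Fin (Fintype.card V)) (hi : i < k) : (Q *ᵥ a) (e i) = 0 :=
    congrFun (LinearMap.mem_ker.1 hker) ⟨i, hi⟩
  have hform : star a ⬝ᵥ (Pᴴ * (A - r • (1 : Matrix V V 𝕜)) * P) *ᵥ a =
      ((∑ i, (hA.eigenvalues₀ i - r) * ‖(Q *ᵥ a) (e i)‖ ^ 2 : ℝ) : 𝕜) := by
    have heigenvalue (i) : hA.eigenvalues (e i) = hA.eigenvalues₀ i :=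
      congrArg hA.eigenvalues₀ (e.symm_apply_apply i)
    have hconj : Pᴴ * (A - r • (1 : Matrix V V 𝕜)) * P =
        Qᴴ * diagonal (fun v => ((hA.eigenvalues v - r : ℝ) : 𝕜)) * Q := by
      simp only [sub_smul_one_eq_conj_diagonal hA, Q, conjTranspose_mul,
        conjTranspose_conjTranspose, Matrix.mul_assoc]
    rw [hconj, ← mulVec_mulVec, ← mulVec_mulVec, dotProduct_mulVec, vecMul_conjTranspose,
      star_star, dotProduct, ← e.sum_comp, RCLike.ofReal_sum]
    refine Finset.sum_congr rfl fun i _ => ?_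
    rw [mulVec_diagonal, heigenvalue, RCLike.ofReal_mul, RCLike.ofReal_pow, ← RCLike.conj_mul,
      Pi.star_apply, ← starRingEnd_apply]
    ring
  have hpos := hP.dotProduct_mulVec_pos ha
  rw [hform, RCLike.ofReal_pos] at hpos
  refine hpos.not_ge (Finset.sum_nonpos fun i _ => ?_)
  rcases lt_or_ge i k with hi | hi
  · simp [hzero i hi]
  · exact mul_nonpos_of_nonpos_of_nonneg
      (sub_nonpos.2 ((hA.eigenvalues₀_antitone hi).trans hle)) (sq_nonneg _)

theorem lt_eigenvalues₀_of_posDef_submatrix {κ : Type*} [Fintype κ] (hA : A.IsHermitian) {r : ℝ}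
    (f : κ → V) (P : Matrix κ ι 𝕜)
    (hP : (Pᴴ * (A - r • (1 : Matrix V V 𝕜)).submatrix f f * P).PosDef)
    (k : Fin (Fintype.card V)) (hk : k < Fintype.card ι) : r < hA.eigenvalues₀ k := by
  classical
  let E : Matrix V κ 𝕜 := (1 : Matrix V V 𝕜).submatrix id f
  have hE (B : Matrix V V 𝕜) : Eᴴ * B * E = B.submatrix f f := by
    ext i j
    simp [E, Matrix.mul_apply, Matrix.one_apply]
  refine lt_eigenvalues₀_of_posDef hA (E * P) ?_ k hk
  rwa [conjTranspose_mul, Matrix.mul_assoc Pᴴ, Matrix.mul_assoc Pᴴ, ← Matrix.mul_assoc _ E,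
    hE, ← Matrix.mul_assoc]

end Eigenvalues

section Join

variable {V V' W W' : Type*} {G : SimpleGraph V} {G' : SimpleGraph V'} {H : SimpleGraph W}
  {H' : SimpleGraph W'}

@[simp]
theorem join_adj_inl_inl {a b : V} : (G.join H).Adj (.inl a) (.inl b) ↔ G.Adj a b := by
  simp [join]

@[simp]
theorem join_adj_inr_inr {a b : W} : (G.join H).Adj (.inr a) (.inr b) ↔ H.Adj a b := by
  simp [join]

@[simp]
theorem join_adj_inl_inr {a : V} {b : W} : (G.join H).Adj (.inl a) (.inr b) := by
  simp [join]

@[simp]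
theorem join_adj_inr_inl {a : W} {b : V} : (G.join H).Adj (.inr a) (.inl b) := by
  simp [join]

/-- The inclusion of the left side of a join. -/
def joinInl (G : SimpleGraph V) (H : SimpleGraph W) : G ↪g G.join H where
  toEmbedding := .inl
  map_rel_iff' := join_adj_inl_inl

/-- The isomorphism of joins induced by isomorphisms of both sides. -/
def joinCongr (e : G ≃g G') (f : H ≃g H') : G.join H ≃g G'.join H' where
  toEquiv := Equiv.sumCongr e.toEquiv f.toEquiv
  map_rel_iff' := by rintro (a | a) (b | b) <;> simp [e.map_adj_iff, f.map_adj_iff]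

/-- The commutativity of the join. -/
def joinComm (G : SimpleGraph V) (H : SimpleGraph W) : G.join H ≃g H.join G where
  toEquiv := Equiv.sumComm V W
  map_rel_iff' := by rintro (a | a) (b | b) <;> simp

@[simp]
theorem top_join_top : (⊤ : SimpleGraph V).join (⊤ : SimpleGraph W) = ⊤ := by
  ext (a | a) (b | b) <;> simp

theorem nonempty_iso_join_induce_compl (s : Set V) (hs : ∀ u ∈ s, ∀ v ∉ s, G.Adj u v) :
    Nonempty (G ≃g (G.induce s).join (G.induce sᶜ)) := by
  classical
  refine ⟨Iso.symm ⟨Equiv.Set.sumCompl s, ?_⟩⟩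
  rintro (u | u) (v | v)
  · simp
  · simpa using hs u u.2 v v.2
  · simpa using (hs v v.2 u u.2).symm
  · simp

theorem ediam_le_two_of_iso_join [Nonempty V'] [Nonempty W'] (e : G ≃g G'.join H') :
    G.ediam ≤ 2 := by
  refine ediam_le_of_edist_le fun u v => ?_
  by_contra! hlt
  obtain ⟨-, hadj, hcommon⟩ := two_lt_edist_iff.1 hlt
  suffices ∃ w, (G'.join H').Adj (e u) w ∧ (G'.join H').Adj (e v) w by
    obtain ⟨w, hu, hv⟩ := this
    obtain ⟨w, rfl⟩ := e.surjective w
    exact hcommon.subset ⟨e.map_adj_iff.1 hu, e.map_adj_iff.1 hv⟩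
  rw [← e.map_adj_iff] at hadj
  rcases hu : e u with a | a <;> rcases hv : e v with b | b
  · exact ⟨.inr (Classical.arbitrary W'), by simp⟩
  · simp [hu, hv] at hadj
  · simp [hu, hv] at hadj
  · exact ⟨.inl (Classical.arbitrary V'), by simp⟩

theorem nonempty_iso_clique [Finite V] : Nonempty ((⊤ : SimpleGraph V) ≃g clique (Nat.card V)) :=
  ⟨Iso.completeGraph (Finite.equivFin V)⟩

theorem nonempty_clique_add_iso_join (r s : ℕ) :
    Nonempty (clique (r + s) ≃g (clique r).join (clique s)) := by
  rw [top_join_top]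
  exact ⟨Iso.completeGraph finSumFinEquiv.symm⟩

end Join

section InducedP3

variable {V : Type*} {G : SimpleGraph V}

theorem hasInducedP3_iff :
    G.HasInducedP3 ↔ ∃ x y z, G.Adj x y ∧ G.Adj y z ∧ x ≠ z ∧ ¬ G.Adj x z := by
  constructor
  · rintro ⟨f⟩
    exact ⟨f 0, f 1, f 2, by simp [f.map_adj_iff, pathGraph_adj]⟩
  · rintro ⟨x, y, z, hxy, hyz, hne, hxz⟩
    rw [HasInducedP3, ← compl_isIndContained_compl]
    exact ⟨IsPathGraph3Compl.pathGraph3ComplEmbedding (v := y) (w₁ := x) (w₂ := z)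
      ⟨by simp [hne, hxz], by simp [hxy.symm], by simp [hyz]⟩⟩

theorem adj_iff_of_not_hasInducedP3 (hP : ¬ G.HasInducedP3) {u v : V} :
    G.Adj u v ↔ u ≠ v ∧ G.connectedComponentMk u = G.connectedComponentMk v := by
  refine ⟨fun h => ⟨h.ne, ConnectedComponent.sound h.reachable⟩, fun h => ?_⟩
  suffices u = v ∨ G.Adj u v from this.resolve_left h.1
  have hreach := (reachable_iff_reflTransGen u v).1 (ConnectedComponent.exact h.2)
  clear h
  induction hreach with
  | refl => exact .inl rfl
  | tail _ hvw ih =>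
    rcases ih with rfl | huv
    · exact .inr hvw
    · by_contra! h
      exact hP (hasInducedP3_iff.2 ⟨_, _, _, huv, hvw, h⟩)

theorem copies_clique_adj {m k : ℕ} {x y : Fin m × Fin k} :
    (copies m (clique k)).Adj x y ↔ x ≠ y ∧ x.1 = y.1 := by
  simp only [copies, top_adj, ne_eq, Prod.ext_iff]
  tauto

/-- A single copy of a graph is that graph. -/
def copiesOneIso (G : SimpleGraph V) : copies 1 G ≃g G where
  toEquiv := Equiv.uniqueProd V (Fin 1)
  map_rel_iff' := by simp [copies]

variable [Finite V]

theorem nonempty_induce_iso_copies_clique (hP : ¬ G.HasInducedP3) (T : Set G.ConnectedComponent)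
    {k : ℕ} (hT : ∀ c ∈ T, c.supp.ncard = k) :
    Nonempty (G.induce {v | G.connectedComponentMk v ∈ T} ≃g copies T.ncard (clique k)) := by
  let index : T ≃ Fin T.ncard := Finite.equivFin T
  let label (c : T) : {v // G.connectedComponentMk v = c} ≃ Fin k :=
    Finite.equivFinOfCardEq (hT c c.2)
  let e : {v | G.connectedComponentMk v ∈ T} ≃ Fin T.ncard × Fin k :=
    (Equiv.sigmaSubtypeFiberEquivSubtype G.connectedComponentMk fun _ => Iff.rfl).symm.trans <|
      (Equiv.sigmaCongrRight label).trans <| (Equiv.sigmaEquivProd _ _).trans <|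
        index.prodCongr (.refl _)
  have he (v) : (e v).1 = index ⟨G.connectedComponentMk v, v.2⟩ := rfl
  refine ⟨⟨e, fun {u v} => ?_⟩⟩
  rw [copies_clique_adj, e.injective.ne_iff, he, he, index.injective.eq_iff, Subtype.mk.injEq,
    comap_adj, adj_iff_of_not_hasInducedP3 hP, Function.Embedding.subtype_apply]
  simp [Subtype.ext_iff]

theorem nonempty_iso_copies_sum_copies (hP : ¬ G.HasInducedP3) (T : Set G.ConnectedComponent)
    {k l : ℕ} (hk : ∀ c ∈ T, c.supp.ncard = k) (hl : ∀ c ∉ T, c.supp.ncard = l) :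
    Nonempty (G ≃g copies T.ncard (clique k) ⊕g copies Tᶜ.ncard (clique l)) := by
  classical
  let s : Set V := {v | G.connectedComponentMk v ∈ T}
  have hsplit : G.induce s ⊕g G.induce sᶜ ≃g G := by
    refine ⟨Equiv.Set.sumCompl s, ?_⟩
    have hcross {u v : V} (hu : u ∈ s) (hv : v ∉ s) : ¬ G.Adj u v := fun h =>
      hv (by rwa [Set.mem_ofPred_eq, ← ConnectedComponent.sound h.reachable])
    rintro (u | u) (v | v)
    · simp
    · simpa using hcross u.2 v.2
    · simpa [adj_comm] using hcross v.2 u.2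
    · simp
  obtain ⟨e⟩ := nonempty_induce_iso_copies_clique hP T hk
  obtain ⟨f⟩ := nonempty_induce_iso_copies_clique hP Tᶜ hl
  exact ⟨hsplit.symm.trans (e.sumCongr f)⟩

theorem clique_sum_clique_isIndContained (hP : ¬ G.HasInducedP3) {c d : G.ConnectedComponent}
    (hcd : c ≠ d) {k l : ℕ} (hk : k ≤ c.supp.ncard) (hl : l ≤ d.supp.ncard) :
    clique k ⊕g clique l ⊴ G := by
  let φ : Fin k ↪ c.supp := (Fin.castLEEmb hk).trans (Finite.equivFin c.supp).symm.toEmbedding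
  let ψ : Fin l ↪ d.supp := (Fin.castLEEmb hl).trans (Finite.equivFin d.supp).symm.toEmbedding
  have hφ (i) : G.connectedComponentMk (φ i : V) = c := (φ i).2
  have hψ (i) : G.connectedComponentMk (ψ i : V) = d := (ψ i).2
  have hne (i j) : (φ i : V) ≠ ψ j := fun h => hcd (by rw [← hφ i, h, hψ])
  refine ⟨⟨⟨Sum.elim (fun i => (φ i : V)) fun i => (ψ i : V), ?_⟩, ?_⟩⟩
  · exact (Subtype.val_injective.comp φ.injective).sumElim
      (Subtype.val_injective.comp ψ.injective) hne
  · rintro (i | i) (j | j) <;>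
      simp [adj_iff_of_not_hasInducedP3 hP, hφ, hψ, hcd, hcd.symm, Subtype.val_inj]

theorem classification_of_not_hasInducedP3 [Nonempty V] (hP : ¬ G.HasInducedP3)
    (hK : ¬ clique 3 ⊕g clique 2 ⊴ G) :
    (∃ r, 1 ≤ r ∧ Nonempty (G ≃g clique r)) ∨
    (∃ s t, 3 ≤ s ∧ 1 ≤ t ∧ Nonempty (G ≃g cliqueUnionIsolated s t)) ∨
    (∃ m t, 2 ≤ m + t ∧ Nonempty (G ≃g edgesUnionIsolated m t)) := by
  by_cases htop : G = ⊤
  · subst htop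
    exact .inl ⟨Nat.card V, Nat.card_pos, nonempty_iso_clique⟩
  have : Nontrivial G.ConnectedComponent := by
    obtain ⟨u, v, hne, hadj⟩ := ne_top_iff_exists_not_adj.1 htop
    exact ⟨_, _, fun h => hadj ((adj_iff_of_not_hasInducedP3 hP).2 ⟨hne, h⟩)⟩
  have hpos (c : G.ConnectedComponent) : 0 < c.supp.ncard :=
    c.nonempty_supp.ncard_pos
  right
  by_cases hbig : ∃ c : G.ConnectedComponent, 3 ≤ c.supp.ncard
  · obtain ⟨c, hc⟩ := hbig
    left
    have hone (d : G.ConnectedComponent) (hd : d ∉ ({c} : Set G.ConnectedComponent)) :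
        d.supp.ncard = 1 := by
      by_contra h
      exact hK (clique_sum_clique_isIndContained hP (Ne.symm hd) hc (by have := hpos d; omega))
    obtain ⟨e⟩ := nonempty_iso_copies_sum_copies hP {c} (k := c.supp.ncard) (by simp) hone
    rw [Set.ncard_singleton] at e
    exact ⟨_, _, hc, (Set.nonempty_compl_of_nontrivial c).ncard_pos,
      ⟨e.trans ((copiesOneIso _).sumCongr .refl)⟩⟩
  · push Not at hbig
    right
    let T : Set G.ConnectedComponent := {c | c.supp.ncard = 2}
    refine ⟨T.ncard, Tᶜ.ncard, ?_, nonempty_iso_copies_sum_copies hP T (fun _ h => h)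
      fun c hc => ?_⟩
    · rw [Set.ncard_add_ncard_compl]
      exact Finite.one_lt_card
    · have : c.supp.ncard ≠ 2 := hc
      have := hpos c
      have := hbig c
      omega

end InducedP3

section DistanceMatrix

variable {V : Type*} [DecidableEq V] {G : SimpleGraph V}

theorem distanceMatrix_add_one_of_ediam_le_two [DecidableRel G.Adj] (hd : G.ediam ≤ 2) :
    G.distanceMatrix + 1 = of 1 + Gᶜ.adjMatrix ℝ := by
  ext u v
  by_cases heq : u = v
  · simp [distanceMatrix, heq]
  by_cases hadj : G.Adj u v
  · simp [distanceMatrix, dist_eq_one_iff_adj.2 hadj, heq, hadj]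
  have hnonempty : (G.commonNeighbors u v).Nonempty := by
    by_contra! h
    exact (two_lt_edist_iff.2 ⟨heq, hadj, h⟩).not_ge (ediam_le_iff.1 hd u v)
  have hdist : G.dist u v = 2 := by
    simp [SimpleGraph.dist, edist_eq_two_iff.2 ⟨heq, hadj, hnonempty⟩]
  simp [distanceMatrix, hdist, heq, hadj, one_add_one_eq_two]

variable [Fintype V]

theorem not_clique_three_sum_clique_two_isIndContained (hd : G.ediam ≤ 2)
    (hmin : ∀ i, -3 ≤ G.distanceEigenvalue i) : ¬ clique 3 ⊕g clique 2 ⊴ G := by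
  classical
  rintro ⟨f⟩
  have hshift : G.distanceMatrix - (-3 : ℝ) • (1 : Matrix V V ℝ) =
      of 1 + Gᶜ.adjMatrix ℝ + (2 : ℝ) • (1 : Matrix V V ℝ) := by
    rw [← distanceMatrix_add_one_of_ediam_le_two hd]
    module
  have hM : (of 1 + Gᶜ.adjMatrix ℝ + (2 : ℝ) • (1 : Matrix V V ℝ)).submatrix f f =
      fromBlocks (of 1 + 2) (of 2) (of 2) (of 1 + 2) := by
    ext (i | i) (j | j) <;>
      simp [Matrix.one_apply, Matrix.ofNat_apply, one_add_one_eq_two]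
  have hpsd := (posSemidef_sub_smul_one G.distanceMatrix_isHermitian hmin).submatrix f
  rw [hshift, hM] at hpsd
  have hnonneg := hpsd.dotProduct_mulVec_nonneg (Sum.elim (fun _ => -1) fun _ => 1)
  norm_num [dotProduct, mulVec, Finset.sum_add_distrib, Matrix.ofNat_apply] at hnonneg

theorem adj_of_common_neighbor (hd : G.ediam ≤ 2) {hV : 2 < Fintype.card V}
    (h₃ : G.distanceEigenvalue ⟨2, hV⟩ ≤ -1) {x y z w u : V} (hxy : G.Adj x y) (hyz : G.Adj y z)
    (hne : x ≠ z) (hxz : ¬ G.Adj x z) (hwx : G.Adj w x) (hwy : G.Adj w y) (hwz : G.Adj w z)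
    (hwu : G.Adj w u) (hyu : y ≠ u) : G.Adj y u := by
  classical
  by_contra hnadj
  have hshift : G.distanceMatrix - (-1 : ℝ) • (1 : Matrix V V ℝ) = of 1 + Gᶜ.adjMatrix ℝ := by
    rw [← distanceMatrix_add_one_of_ediam_le_two hd]
    module
  let f : Fin 5 → V := ![x, z, y, u, w]
  let a : ℝ := Gᶜ.adjMatrix ℝ u x
  let b : ℝ := Gᶜ.adjMatrix ℝ u z
  let M : Matrix (Fin 5) (Fin 5) ℝ :=
    !![1, 2, 1, 1 + a, 1; 2, 1, 1, 1 + b, 1; 1, 1, 1, 2, 1; 1 + a, 1 + b, 2, 1, 1; 1, 1, 1, 1, 1]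
  have hM : (of 1 + Gᶜ.adjMatrix ℝ).submatrix f f = M := by
    ext i j
    fin_cases i <;> fin_cases j <;>
      simp [M, f, a, b, *, hxy.symm, hyz.symm, hne.symm, hwx.symm, hwy.symm, hwz.symm, hwu.symm,
        hyu.symm, G.adj_comm z x, G.adj_comm u y, adj_comm _ x u, adj_comm _ z u,
        one_add_one_eq_two]
  -- As `w` is isolated in `Gᶜ`, subtracting multiples of it from the other vectors removes the
  -- all-ones part. For what is left, `e_x + e_z - (a + b) e_y` and `e_y + e_u` are orthogonal.
  let P : Matrix (Fin 5) (Fin 3) ℝ :=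
    !![1, 0, 0; 1, 0, 0; -(a + b), 1, 0; 0, 1, 0; a + b - 2, -2, 1]
  have hPMP : Pᴴ * M * P = diagonal ![2, 2, 1] := by
    ext i j
    fin_cases i <;> fin_cases j <;>
      simp [P, M, Matrix.mul_apply, Fin.sum_univ_five] <;> ring
  refine h₃.not_gt (lt_eigenvalues₀_of_posDef_submatrix G.distanceMatrix_isHermitian f P ?_
    ⟨2, hV⟩ (by simp))
  rw [hshift, hM, hPMP]
  refine PosDef.diagonal fun i => ?_
  fin_cases i <;> simp

theorem isUniversal_of_isUniversal (hd : G.ediam ≤ 2) {hV : 2 < Fintype.card V}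
    (h₃ : G.distanceEigenvalue ⟨2, hV⟩ ≤ -1) {w x y z : V} (hw : G.IsUniversal w)
    (hxy : G.Adj x y) (hyz : G.Adj y z) (hne : x ≠ z) (hxz : ¬ G.Adj x z) : G.IsUniversal y := by
  rcases eq_or_ne w y with rfl | hwy
  · exact hw
  have hwx : w ≠ x := fun h => hxz (h ▸ hw (h ▸ hne))
  have hwz : w ≠ z := fun h => hxz (h ▸ hw (h ▸ hne.symm)).symm
  intro u hyu
  rcases eq_or_ne w u with rfl | hwu
  · exact (hw hwy).symm
  · exact adj_of_common_neighbor hd h₃ hxy hyz hne hxz (hw hwx) (hw hwy) (hw hwz) (hw hwu) hyu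

theorem not_hasInducedP3_induce_compl_universalVerts (hd : G.ediam ≤ 2) {hV : 2 < Fintype.card V}
    (h₃ : G.distanceEigenvalue ⟨2, hV⟩ ≤ -1) (hne : G.universalVerts.Nonempty) :
    ¬ (G.induce G.universalVertsᶜ).HasInducedP3 := by
  obtain ⟨w, hw⟩ := hne
  rw [hasInducedP3_iff]
  rintro ⟨x, y, z, hxy, hyz, hxz, hnadj⟩
  exact y.2 (isUniversal_of_isUniversal hd h₃ hw hxy hyz (Subtype.val_injective.ne hxz) hnadj)

variable {V₁ V₂ : Type*} [Nonempty V₁] [Nonempty V₂] {G₁ : SimpleGraph V₁} {G₂ : SimpleGraph V₂}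

theorem one_lt_ncard_universalVerts_and_nonempty_compl (e : G ≃g G₁.join G₂)
    {hV : 2 < Fintype.card V} (h₃ : G.distanceEigenvalue ⟨2, hV⟩ ≤ -1) (hP : G₁.HasInducedP3) :
    1 < G.universalVerts.ncard ∧ G.universalVertsᶜ.Nonempty := by
  have hd := ediam_le_two_of_iso_join e
  obtain ⟨x, y, z, hxy, hyz, hne, hxz⟩ := hasInducedP3_iff.1 hP
  let left (v : V₁) : V := e.symm (.inl v)
  let right (v : V₂) : V := e.symm (.inr v)
  have hleft {u v} : G.Adj (left u) (left v) ↔ G₁.Adj u v := by simp [left, e.symm.map_adj_iff]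
  have hcross {u c} : G.Adj (left u) (right c) := by simp [left, right, e.symm.map_adj_iff]
  have hinj : Function.Injective left := e.symm.injective.comp Sum.inl_injective
  have hnadj : ¬ G.Adj (left x) (left z) := mt hleft.1 hxz
  let c := Classical.arbitrary V₂
  have hy : G.IsUniversal (left y) := by
    intro u hyu
    obtain ⟨u | u, rfl⟩ := e.symm.surjective u
    · exact adj_of_common_neighbor hd h₃ (hleft.2 hxy) (hleft.2 hyz) (hinj.ne hne) hnadj
        (w := right c) hcross.symm hcross.symm hcross.symm hcross.symm hyu
    · exact hcross
  have hc : G.IsUniversal (right c) :=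
    isUniversal_of_isUniversal hd h₃ hy hcross hcross.symm (hinj.ne hne) hnadj
  exact ⟨(Set.one_lt_ncard).2 ⟨_, hy, _, hc, e.symm.injective.ne Sum.inl_ne_inr⟩,
    left x, fun hx => hnadj (hx (hinj.ne hne))⟩

theorem nonempty_iso_clique_join_of_hasInducedP3 (e : G ≃g G₁.join G₂) {hV : 2 < Fintype.card V}
    (h₃ : G.distanceEigenvalue ⟨2, hV⟩ ≤ -1) (hP : G₁.HasInducedP3) :
    ∃ (r q : ℕ) (F : SimpleGraph (Fin q)), 2 ≤ r ∧ 1 ≤ q ∧ ¬ F.HasInducedP3 ∧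
      Nonempty (G ≃g (clique r).join F) := by
  obtain ⟨htwo, hcompl⟩ := one_lt_ncard_universalVerts_and_nonempty_compl e h₃ hP
  have hF : ¬ (G.induce G.universalVertsᶜ).HasInducedP3 :=
    not_hasInducedP3_induce_compl_universalVerts (ediam_le_two_of_iso_join e) h₃
      (Set.nonempty_of_ncard_ne_zero (by omega))
  obtain ⟨f⟩ := nonempty_iso_join_induce_compl (G := G) G.universalVerts
    fun u hu v hv => hu (ne_of_mem_of_not_mem hu hv)
  rw [induce_eq_top.2 G.isClique_universalVerts] at f
  obtain ⟨g⟩ := nonempty_iso_clique (V := G.universalVerts)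
  let φ := Iso.map (Finite.equivFin (G.universalVertsᶜ : Set V)) (G.induce G.universalVertsᶜ)
  exact ⟨_, _, _, htwo, hcompl.ncard_pos, fun h => hF (h.trans φ.symm.isIndContained),
    ⟨f.trans (joinCongr g φ)⟩⟩

theorem classification_left_of_iso_join (e : G ≃g G₁.join G₂)
    (hmin : ∀ i, -3 ≤ G.distanceEigenvalue i) (hP : ¬ G₁.HasInducedP3) :
    (∃ r, 1 ≤ r ∧ Nonempty (G₁ ≃g clique r)) ∨
    (∃ s t, 3 ≤ s ∧ 1 ≤ t ∧ Nonempty (G₁ ≃g cliqueUnionIsolated s t)) ∨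
    (∃ m t, 2 ≤ m + t ∧ Nonempty (G₁ ≃g edgesUnionIsolated m t)) := by
  have hcontained : G₁ ⊴ G := ⟨e.symm.toEmbedding.comp (joinInl G₁ G₂)⟩
  have : Finite V₁ := .of_injective _ hcontained.some.injective
  exact classification_of_not_hasInducedP3 hP fun h =>
    not_clique_three_sum_clique_two_isIndContained (ediam_le_two_of_iso_join e) hmin
      (h.trans hcontained)

end DistanceMatrix

end DistanceSpectrum

open DistanceSpectrum

theorem theorem3p12_general {V V₁ V₂ : Type*} [Fintype V] [DecidableEq V] [Nonempty V₁]
    [Nonempty V₂] (G : SimpleGraph V) (G₁ : SimpleGraph V₁) (G₂ : SimpleGraph V₂)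
    (hjoin : Nonempty (G ≃g G₁.join G₂)) :
    (G ≠ ⊤ → (∀ i, -3 ≤ G.distanceEigenvalue i) →
      (¬ G₁.HasInducedP3 ∧ ¬ G₂.HasInducedP3) →
        (∃ r s t : ℕ, 1 ≤ r ∧ 1 ≤ t ∧ 3 ≤ s ∧
          Nonempty (G ≃g (clique r).join (cliqueUnionIsolated s t))) ∨
        (∃ r m t : ℕ, 1 ≤ r ∧ 2 ≤ m + t ∧
          Nonempty (G ≃g (clique r).join (edgesUnionIsolated m t))) ∨
        (∃ s₁ t₁ s₂ t₂ : ℕ, 3 ≤ s₁ ∧ 3 ≤ s₂ ∧ 1 ≤ t₁ ∧ 1 ≤ t₂ ∧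
          Nonempty (G ≃g (cliqueUnionIsolated s₁ t₁).join (cliqueUnionIsolated s₂ t₂))) ∨
        (∃ s t₁ m t₂ : ℕ, 3 ≤ s ∧ 1 ≤ t₁ ∧ 2 ≤ m + t₂ ∧
          Nonempty (G ≃g (cliqueUnionIsolated s t₁).join (edgesUnionIsolated m t₂))) ∨
        (∃ m₁ t₁ m₂ t₂ : ℕ, 2 ≤ m₁ + t₁ ∧ 2 ≤ m₂ + t₂ ∧
          Nonempty (G ≃g (edgesUnionIsolated m₁ t₁).join (edgesUnionIsolated m₂ t₂)))) ∧
    (∀ hV : 2 < Fintype.card V, G.distanceEigenvalue ⟨2, hV⟩ ≤ -1 →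
      (G₁.HasInducedP3 ∨ G₂.HasInducedP3) →
        ∃ (r p q : ℕ) (F₁ : SimpleGraph (Fin p)) (F₂ : SimpleGraph (Fin q)),
          1 ≤ r ∧ 1 ≤ p ∧ 1 ≤ q ∧ ¬ F₁.HasInducedP3 ∧ ¬ F₂.HasInducedP3 ∧
          Nonempty (G ≃g ((clique r).join F₁).join F₂)) := by
  obtain ⟨e⟩ := hjoin
  have e' := e.trans (joinComm G₁ G₂)
  refine ⟨fun hne hmin ⟨hP₁, hP₂⟩ => ?_, fun hV h₃ hP => ?_⟩
  · rcases classification_left_of_iso_join e hmin hP₁ with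
      ⟨r, hr, ⟨f⟩⟩ | ⟨s, t, hs, ht, ⟨f⟩⟩ | ⟨m, t, hm, ⟨f⟩⟩ <;>
    rcases classification_left_of_iso_join e' hmin hP₂ with
      ⟨r', hr', ⟨f'⟩⟩ | ⟨s', t', hs', ht', ⟨f'⟩⟩ | ⟨m', t', hm', ⟨f'⟩⟩ <;>
    have g := e.trans (joinCongr f f') <;>
    have g' := e'.trans (joinCongr f' f)
    · have hG := Iso.isIndContained g
      rw [top_join_top] at hG
      exact absurd (eq_top_of_isIndContained_top hG) hne
    · exact .inl ⟨r, s', t', hr, ht', hs', ⟨g⟩⟩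
    · exact .inr (.inl ⟨r, m', t', hr, hm', ⟨g⟩⟩)
    · exact .inl ⟨r', s, t, hr', ht, hs, ⟨g'⟩⟩
    · exact .inr (.inr (.inl ⟨s, t, s', t', hs, hs', ht, ht', ⟨g⟩⟩))
    · exact .inr (.inr (.inr (.inl ⟨s, t, m', t', hs, ht, hm', ⟨g⟩⟩)))
    · exact .inr (.inl ⟨r', m, t, hr', hm, ⟨g'⟩⟩)
    · exact .inr (.inr (.inr (.inl ⟨s', t', m, t, hs', ht', hm, ⟨g'⟩⟩)))
    · exact .inr (.inr (.inr (.inr ⟨m, t, m', t', hm, hm', ⟨g⟩⟩)))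
  · obtain ⟨r, q, F, hr, hq, hF, ⟨f⟩⟩ :=
      hP.elim (nonempty_iso_clique_join_of_hasInducedP3 e h₃)
        (nonempty_iso_clique_join_of_hasInducedP3 e' h₃)
    obtain ⟨r, rfl⟩ := Nat.exists_eq_add_of_le' hr
    obtain ⟨g⟩ := nonempty_clique_add_iso_join (r + 1) 1
    exact ⟨r + 1, 1, q, clique 1, F, by omega, le_rfl, hq, by simp [hasInducedP3_iff], hF,
      ⟨f.trans (joinCongr g .refl)⟩⟩

theorem theorem3p12 {V V₁ V₂ : Type*} [Fintype V] [DecidableEq V] [Nonempty V₁] [Nonempty V₂]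
    (G : SimpleGraph V) (G₁ : SimpleGraph V₁) (G₂ : SimpleGraph V₂)
    (hjoin : Nonempty (G ≃g G₁.join G₂)) (hG : G.InClassG) :
    ((¬ G₁.HasInducedP3 ∧ ¬ G₂.HasInducedP3) →
      (∃ r s t : ℕ, 1 ≤ r ∧ 1 ≤ t ∧ 3 ≤ s ∧
        Nonempty (G ≃g (SimpleGraph.clique r).join (SimpleGraph.cliqueUnionIsolated s t))) ∨
      (∃ r m t : ℕ, 1 ≤ r ∧ 2 ≤ m + t ∧
        Nonempty (G ≃g (SimpleGraph.clique r).join (SimpleGraph.edgesUnionIsolated m t))) ∨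
      (∃ s₁ t₁ s₂ t₂ : ℕ, 3 ≤ s₁ ∧ 3 ≤ s₂ ∧ 1 ≤ t₁ ∧ 1 ≤ t₂ ∧
        Nonempty (G ≃g (SimpleGraph.cliqueUnionIsolated s₁ t₁).join
          (SimpleGraph.cliqueUnionIsolated s₂ t₂))) ∨
      (∃ s t₁ m t₂ : ℕ, 3 ≤ s ∧ 1 ≤ t₁ ∧ 2 ≤ m + t₂ ∧
        Nonempty (G ≃g (SimpleGraph.cliqueUnionIsolated s t₁).join
          (SimpleGraph.edgesUnionIsolated m t₂))) ∨
      (∃ m₁ t₁ m₂ t₂ : ℕ, 2 ≤ m₁ + t₁ ∧ 2 ≤ m₂ + t₂ ∧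
        Nonempty (G ≃g (SimpleGraph.edgesUnionIsolated m₁ t₁).join
          (SimpleGraph.edgesUnionIsolated m₂ t₂)))) ∧
    ((G₁.HasInducedP3 ∨ G₂.HasInducedP3) →
      ∃ (r p q : ℕ) (F₁ : SimpleGraph (Fin p)) (F₂ : SimpleGraph (Fin q)),
        1 ≤ r ∧ 1 ≤ p ∧ 1 ≤ q ∧ ¬ F₁.HasInducedP3 ∧ ¬ F₂.HasInducedP3 ∧
        Nonempty (G ≃g ((SimpleGraph.clique r).join F₁).join F₂)) := by
  obtain ⟨h₁, h₂⟩ := theorem3p12_general G G₁ G₂ hjoin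
  obtain ⟨-, hne, hn, hmin, h₃⟩ := hG
  exact ⟨h₁ hne fun i => hmin.trans (G.distanceMatrix_isHermitian.eigenvalues₀_antitone
    (Fin.mk_le_mk.2 (by omega))), h₂ _ h₃⟩
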